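/- Conventions. Let $(X,d)$ be a finite metric space, let $p\ge 1$ be real and let $k\ge 1$ be an integer. For a probability measure $\mu$ on $X$, let $C^{\mathrm{med}}_{k,p}(\mu)$ be the collection of all sets $S\subseteq \mathrm{supp}(\mu)$ with $1\le \#S\le k$ that minimize $\int_X \min_{x\in S} d(x,y)^p\,d\mu(y)$ among all such sets, and let $d_{\mathrm H}$ be the Hausdorff metric on non-empty subsets of $X$. For a transition matrix $P$ on $X$, a state $y$ is accessible from $x$ if $P^n(x,y)>0$ for some $n\ge 0$, and a state $x$ is inessential if some state accessible from $x$ does not have $x$ accessible from it. Theorem 4.4. (1) Let $P$ be a transition matrix on $X$, and let $X=X_0\sqcup X_1$ be a partition into non-empty sets such that all states in $X_0$ are inessential and $P$ is irreducible and aperiodic on $X_1$. Let $\nu$ be the stationary law of $P$ on $X_1$, and let $Y_1,Y_2,\ldots$ be a Markov chain with transition matrix $P$ and $Y_1\in X_0$ almost surely. Let $(f_n)$ be integers with $0\le f_n\le n$, $f_n\to\infty$ and $f_n/n\to 0$, and put $\bar\nu_n^f:=\frac1{n-f_n}\sum_{i=f_n+1}^n\delta_{Y_i}$ (which is defined for all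 large $n$). Then, for all $p\ge 1$ and $k\ge 1$, almost surely, $C^{\mathrm{med}}_{k,p}(\bar\nu_n^f)$ is non-empty for all large $n$ and $$\max_{S_n\in C^{\mathrm{med}}_{k,p}(\bar\nu_n^f)}\ \min_{S\in C^{\mathrm{med}}_{k,p}(\nu)} d_{\mathrm H}(S_n,S)\longrightarrow 0 .$$ (2) Without burn-in this can fail. Let $X=\{-1,0,1\}$ with the metric of the real line, and let $$P=\begin{pmatrix}1/2&0&1/2\\1/3&1/3&1/3\\1/2&0&1/2\end{pmatrix}$$ (states in the order $-1,0,1$). Then $X_0=\{0\}$ and $X_1=\{-1,1\}$ are as in (1), the law $\nu=\frac12\delta_{-1}+\frac12\delta_1$ is stationary, and for every Markov chain $Y_1,Y_2,\ldots$ with transition matrix $P$ and $Y_1=0$ almost surely, the empirical measures $\bar\nu_n:=\frac1n\sum_{i=1}^n\delta_{Y_i}$ satisfy, for every $p\ge 1$, $$\mathbb P\Big(\max_{S_n\in C^{\mathrm{med}}_{1,p}(\bar\nu_n)}\ \min_{S\in C^{\mathrm{med}}_{1,p}(\nu)} d_{\mathrm H}(S_n,S)\to 0\Big)=0 .$$ 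-/

import Mathlib

open MeasureTheory Filter Topology
open scoped ENNReal

noncomputable section

namespace BurnInMedoids

section Clustering

variable {X : Type*} [MetricSpace X] [MeasurableSpace X]

/-- The feasible sets of cluster centers: `S ⊆ R` with `1 ≤ #S ≤ k`. -/
def feasible (k : ℕ) (R : Set X) : Set (Set X) :=
  {S | S ⊆ R ∧ 1 ≤ S.encard ∧ S.encard ≤ k}

/-- The clustering loss `∫ min_{x ∈ S} d(x, y) ^ p dμ(y)` of a finite non-empty set `S` of centers
(`Metric.infDist y S` is then the minimal distance from `y` to a point of `S`). -/
def loss (p : ℝ) (μ : Measure X) (S : Set X) : ℝ :=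
  ∫ y, Metric.infDist y S ^ p ∂μ

/-- The set of optimal sets of at most `k` cluster centers in the domain `R`: the feasible sets
whose loss is least among all feasible sets. -/
def clusterCenters (p : ℝ) (μ : Measure X) (k : ℕ) (R : Set X) : Set (Set X) :=
  {S | S ∈ feasible k R ∧ IsMinOn (loss p μ) (feasible k R) S}

/-- The set of sets of `(k, p)`-medoids cluster centers of `μ`:
the centers are restricted to the support of `μ`. -/
def medoids (k : ℕ) (p : ℝ) (μ : Measure X) : Set (Set X) :=
  clusterCenters p μ k μ.support

/-- `max_{S ∈ C} min_{T ∈ D} d_H(S, T)`, as an extended non-negative real, where `d_H` is the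
Hausdorff metric. (On a finite space the supremum and infimum over non-empty collections
of sets are attained.) -/
def maxMinHausdorff (C D : Set (Set X)) : ℝ≥0∞ :=
  ⨆ S ∈ C, ⨅ T ∈ D, Metric.hausdorffEDist S T

/-- The empirical measure `(b - a)⁻¹ ∑_{a ≤ i < b} δ_{y i}` of the data points with indices
in `[a, b)`. Sequences of data are indexed from `0`, so the first data point is `y 0`, the first `n`
data points give `empiricalMeasure y 0 n`, and forgetting the first `a` of these
gives `empiricalMeasure y a n`. -/
def empiricalMeasure (y : ℕ → X) (a b : ℕ) : Measure X :=
  (((b - a : ℕ) : ℝ≥0∞))⁻¹ • ∑ i ∈ Finset.Ico a b, Measure.dirac (y i)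

end Clustering

section Chains

variable {X : Type*} [Fintype X] [DecidableEq X]

/-- The state `y` is accessible from `x`. -/
def Accessible (P : Matrix X X ℝ) (x y : X) : Prop := ∃ n : ℕ, 0 < (P ^ n) x y

/-- The state `x` is inessential: some state accessible from `x` does not lead back to `x`. -/
def IsInessential (P : Matrix X X ℝ) (x : X) : Prop :=
  ∃ y, Accessible P x y ∧ ¬ Accessible P y x

/-- `P` is irreducible on the set `A` of states. -/
def IsIrreducibleOn (P : Matrix X X ℝ) (A : Set X) : Prop :=
  ∀ x ∈ A, ∀ y ∈ A, Accessible P x y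

/-- `P` is aperiodic on `A`: for `x ∈ A`, the only common divisor of all `n ≥ 1` with
`P ^ n x x > 0` is `1`. -/
def IsAperiodicOn (P : Matrix X X ℝ) (A : Set X) : Prop :=
  ∀ x ∈ A, ∀ d : ℕ, (∀ n : ℕ, 1 ≤ n → 0 < (P ^ n) x x → d ∣ n) → d = 1

/-- The transition matrix `P` on `X` decomposes `X = X₀ ⊔ X₁` into non-empty sets, where the states
in `X₀` are inessential and `P` is irreducible and aperiodic on `X₁`. -/
structure IsDecomposition (P : Matrix X X ℝ) (X₀ X₁ : Set X) : Prop where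
  stochastic : P ∈ Matrix.rowStochastic ℝ X
  disjoint : Disjoint X₀ X₁
  union_eq : X₀ ∪ X₁ = Set.univ
  nonempty_left : X₀.Nonempty
  nonempty_right : X₁.Nonempty
  inessential : ∀ x ∈ X₀, IsInessential P x
  irreducible : IsIrreducibleOn P X₁
  aperiodic : IsAperiodicOn P X₁

variable [MeasurableSpace X]

/-- `ν` is a stationary law of `P` carried by `A`. -/
structure IsStationaryOn (P : Matrix X X ℝ) (A : Set X) (ν : Measure X) : Prop where
  probability : IsProbabilityMeasure ν
  carried : ν Aᶜ = 0
  stationary : ∀ y, ∑ x, ν.real {x} * P x y = ν.real {y}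

/-- `Y 0, Y 1, …` is a Markov chain with transition matrix `P` under the law `ℙ`. -/
structure IsMarkovChain {Ω : Type*} [MeasurableSpace Ω] (P : Matrix X X ℝ) (Y : ℕ → Ω → X)
    (ℙ : Measure Ω) : Prop where
  measurable : ∀ n, Measurable (Y n)
  transition : ∀ (n : ℕ) (x : ℕ → X),
    ℙ.real {ω | ∀ i ≤ n + 1, Y i ω = x i}
      = ℙ.real {ω | ∀ i ≤ n, Y i ω = x i} * P (x n) (x (n + 1))

end Chains

section Example

/-- The space `{-1, 0, 1}` with the metric inherited from the line. -/
abbrev ThreePoint : Type := Set.Icc (-1 : ℤ) 1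

/-- The point `-1`. -/
def negOne : ThreePoint := ⟨-1, by simp⟩

/-- The point `0`. -/
def zero : ThreePoint := ⟨0, by simp⟩

/-- The point `1`. -/
def one : ThreePoint := ⟨1, by simp⟩

/-- The transition matrix with rows (states in the order `-1, 0, 1`)
`(1/2, 0, 1/2)`, `(1/3, 1/3, 1/3)`, `(1/2, 0, 1/2)`. -/
def threePointMatrix : Matrix ThreePoint ThreePoint ℝ :=
  Matrix.of fun x y => if x = zero then 1 / 3 else if y = zero then 0 else 1 / 2

/-- The uniform law on `{-1, 1}`. -/
def signLaw : Measure ThreePoint :=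
  (2⁻¹ : ℝ≥0∞) • Measure.dirac negOne + (2⁻¹ : ℝ≥0∞) • Measure.dirac one

end Example

end BurnInMedoids

end

/-! With burn-in: for a function `g` centred under `ν`, solving the Poisson equation `h - P h = g`
(`exists_poisson`) writes the sums of `g` along the chain as a martingale plus bounded boundary
terms. The martingale has bounded orthogonal increments, so its second moment grows at most linearly
and it is `o(n)` almost surely. Hence frequencies converge to `ν` (`ae_tendsto_average`), and
dropping `o(n)` initial points does not alter this. The chain is also absorbed in `X₁`, so since `f
n → ∞` the retained sample eventually has support exactly `X₁`, the support of `ν`. Both clustering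
problems then range over the same finite family of sets, and convergence of the losses preserves
every strict inequality between limiting losses. Thus empirical medoids eventually are medoids of
`ν` (`eventually_medoids_subset`), and the distance is eventually exactly `0`.

Without burn-in, the starting point `0` stays in the empirical support forever. Every row of the
three-point matrix has mean `0`, so the partial sums of the chain are an integer martingale with
steps at most `1`. They cannot converge, as the steps are eventually `±1`; hence they are unbounded
on both sides and vanish infinitely often (`ae_frequently_sum_eq_zero`). At each such time `-1` and
`1` have equal mass and `{0}` is a medoid, at distance `1` from the medoids `{-1}` and `{1}` of the
limit. -/

namespace BurnInMedoids

/-! ### Finite histories and the Markov property. -/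

section History

variable {X Ω : Type*}

/-- The path that follows `a` up to time `n` and is constant afterwards. -/
def extendPath {n : ℕ} (a : Fin (n + 1) → X) : ℕ → X :=
  fun i => a ⟨min i n, by omega⟩

/-- The states of `Y` up to time `n`. -/
def history (Y : ℕ → Ω → X) (n : ℕ) (ω : Ω) : Fin (n + 1) → X :=
  fun i => Y i ω

lemma extendPath_history (Y : ℕ → Ω → X) {n i : ℕ} (hi : i ≤ n) (ω : Ω) :
    extendPath (history Y n ω) i = Y i ω := by
  simp [extendPath, history, hi]

lemma history_eq_iff (Y : ℕ → Ω → X) {n : ℕ} (a : Fin (n + 1) → X) (ω : Ω) :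
    history Y n ω = a ↔ ∀ i ≤ n, Y i ω = extendPath a i := by
  constructor
  · rintro rfl i hi
    rw [extendPath_history Y hi]
  · intro h
    ext i
    have hi : (i : ℕ) ≤ n := by omega
    simpa [history, extendPath, hi] using h i hi

lemma eq_extendPath_history_of_dependsOn {F : (ℕ → X) → ℝ} {n : ℕ} (hF : DependsOn F (Set.Iic n))
    (Y : ℕ → Ω → X) (ω : Ω) :
    F (fun i => Y i ω) = F (extendPath (history Y n ω)) :=
  hF fun _ hi => (extendPath_history Y hi ω).symm

variable [MeasurableSpace Ω] [MeasurableSpace X]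

lemma measurable_history {Y : ℕ → Ω → X} (hY : ∀ n, Measurable (Y n)) (n : ℕ) :
    Measurable (history Y n) :=
  measurable_pi_lambda _ fun i => hY i

variable [Fintype X] [MeasurableSingletonClass X]

/-- Such a functional factors through the history, which takes finitely many values. -/
lemma integrable_of_dependsOn {F : (ℕ → X) → ℝ} {n : ℕ} (hF : DependsOn F (Set.Iic n))
    {Y : ℕ → Ω → X} (hY : ∀ n, Measurable (Y n)) (ℙ : Measure Ω) [IsFiniteMeasure ℙ] :
    Integrable (fun ω => F (fun i => Y i ω)) ℙ := by
  simp_rw [eq_extendPath_history_of_dependsOn hF]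
  exact (Integrable.of_finite (μ := ℙ.map (history Y n))
    (f := fun a => F (extendPath a))).comp_measurable (measurable_history hY n)

variable {P : Matrix X X ℝ} {Y : ℕ → Ω → X} {ℙ : Measure Ω}

/-- The Markov property: given the past up to time `n`, the conditional expectation of
`h (Y (n + 1))` is `P h (Y n)`. -/
lemma IsMarkovChain.integral_mul_next [IsFiniteMeasure ℙ] (hY : IsMarkovChain P Y ℙ) {n : ℕ}
    {F : (ℕ → X) → ℝ} (hF : DependsOn F (Set.Iic n)) (h : X → ℝ) :
    ∫ ω, F (fun i => Y i ω) * h (Y (n + 1) ω) ∂ℙ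
      = ∫ ω, F (fun i => Y i ω) * P.mulVec h (Y n ω) ∂ℙ := by
  have hm := measurable_history hY.measurable n
  have hm2 : Measurable fun ω => (history Y n ω, Y (n + 1) ω) := hm.prodMk (hY.measurable _)
  have hl : ∫ ω, F (fun i => Y i ω) * h (Y (n + 1) ω) ∂ℙ
      = ∫ z, F (extendPath z.1) * h z.2 ∂(ℙ.map fun ω => (history Y n ω, Y (n + 1) ω)) := by
    rw [integral_map hm2.aemeasurable (measurable_of_finite _).aestronglyMeasurable]
    simp_rw [eq_extendPath_history_of_dependsOn hF]
  have hr : ∫ ω, F (fun i => Y i ω) * P.mulVec h (Y n ω) ∂ℙ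
      = ∫ a, F (extendPath a) * P.mulVec h (extendPath a n) ∂(ℙ.map (history Y n)) := by
    rw [integral_map hm.aemeasurable (measurable_of_finite _).aestronglyMeasurable]
    simp_rw [eq_extendPath_history_of_dependsOn hF, extendPath_history Y le_rfl]
  rw [hl, hr, integral_fintype .of_finite, integral_fintype .of_finite, Fintype.sum_prod_type]
  refine Finset.sum_congr rfl fun a _ => ?_
  have ha : (ℙ.map (history Y n)).real {a} = ℙ.real {ω | ∀ i ≤ n, Y i ω = extendPath a i} := by
    rw [map_measureReal_apply hm (measurableSet_singleton _)]
    congr 1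
    ext ω
    simp [history_eq_iff]
  have hay : ∀ y, (ℙ.map fun ω => (history Y n ω, Y (n + 1) ω)).real {(a, y)}
      = (ℙ.map (history Y n)).real {a} * P (extendPath a n) y := by
    intro y
    rw [map_measureReal_apply hm2 (measurableSet_singleton _), ha]
    -- Prolonging the history `a` by `y` at time `n + 1` turns the cylinder event into that of the
    -- pair `(a, y)`.
    have := hY.transition n (fun i => if i ≤ n then extendPath a i else y)
    simp only [le_refl, if_true, Nat.not_succ_le_self, if_false] at this
    convert this using 2
    · ext ω
      simp only [Set.mem_preimage, Set.mem_singleton_iff, Prod.mk.injEq, history_eq_iff,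
        Set.mem_ofPred_eq]
      constructor
      · rintro ⟨h1, h2⟩ i hi
        rcases Nat.le_succ_iff.1 hi with h | rfl
        · simp [h, h1 i h]
        · simp [h2]
      · intro h1
        refine ⟨fun i hi => ?_, ?_⟩
        · simpa [hi] using h1 i (by omega)
        · simpa using h1 (n + 1) le_rfl
    · congr 1
      ext ω
      simp only [Set.mem_ofPred_eq]
      exact forall₂_congr fun i hi => by simp [hi]
  simp only [hay, smul_eq_mul, Matrix.mulVec, dotProduct, Finset.mul_sum]
  exact Finset.sum_congr rfl fun y _ => by ring

end History

/-! ### Accessibility, harmonic functions and the Poisson equation. -/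

section Stochastic

open Matrix

variable {X : Type*} [Fintype X] [DecidableEq X] {P : Matrix X X ℝ}

lemma pow_nonneg_of_mem_rowStochastic (hP : P ∈ rowStochastic ℝ X) (n : ℕ) (x y : X) :
    0 ≤ (P ^ n) x y :=
  nonneg_of_mem_rowStochastic (pow_mem hP n)

lemma Accessible.refl (P : Matrix X X ℝ) (x : X) : Accessible P x x := ⟨0, by simp⟩

lemma Accessible.trans (hP : P ∈ rowStochastic ℝ X) {x y z : X} (hxy : Accessible P x y)
    (hyz : Accessible P y z) : Accessible P x z := by
  obtain ⟨m, hm⟩ := hxy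
  obtain ⟨n, hn⟩ := hyz
  refine ⟨m + n, ?_⟩
  rw [pow_add, mul_apply]
  exact (mul_pos hm hn).trans_le <| Finset.single_le_sum
    (f := fun w => (P ^ m) x w * (P ^ n) w z) (fun w _ => mul_nonneg
    (pow_nonneg_of_mem_rowStochastic hP _ _ _) (pow_nonneg_of_mem_rowStochastic hP _ _ _))
    (Finset.mem_univ y)

/-- Among the states accessible from `x`, take one that reaches the fewest states: a step without
return would lead to a state that reaches strictly fewer. -/
lemma exists_accessible_not_isInessential (hP : P ∈ rowStochastic ℝ X) (x : X) :
    ∃ y, Accessible P x y ∧ ¬ IsInessential P y := by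
  obtain ⟨y, hy, hmin⟩ := Set.exists_min_image {y | Accessible P x y}
    (fun y => {z | Accessible P y z}.ncard) (Set.toFinite _) ⟨x, Accessible.refl P x⟩
  refine ⟨y, hy, ?_⟩
  rintro ⟨z, hyz, hzy⟩
  refine (hmin z (hy.trans hP hyz)).not_gt (Set.ncard_lt_ncard ?_ (Set.toFinite _))
  refine ⟨fun w hw => hyz.trans hP hw, fun h => hzy (h (Accessible.refl P y))⟩

/-- The maximum principle for harmonic functions. -/
lemma harmonic_eq_of_accessible (hP : P ∈ rowStochastic ℝ X) {h : X → ℝ} (hh : P *ᵥ h = h)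
    {x y : X} (hx : ∀ z, h z ≤ h x) (hxy : Accessible P x y) : h y = h x := by
  obtain ⟨n, hn⟩ := hxy
  have hpow : (P ^ n) *ᵥ h = h := by
    clear hn
    induction n with
    | zero => simp
    | succ n ih => rw [pow_succ, ← mulVec_mulVec, hh, ih]
  -- The rows of `P ^ n` sum to `1` and `h` is harmonic, so this average of non-negative gaps is
  -- zero and each weighted gap vanishes.
  have hs : ∑ z, (P ^ n) x z * (h x - h z) = 0 := by
    simp_rw [mul_sub, Finset.sum_sub_distrib, ← Finset.sum_mul]
    rw [sum_row_of_mem_rowStochastic (pow_mem hP n)]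
    have := congrFun hpow x
    simp only [mulVec, dotProduct] at this
    rw [this]; ring
  rw [Finset.sum_eq_zero_iff_of_nonneg fun z _ => mul_nonneg
    (pow_nonneg_of_mem_rowStochastic hP _ _ _) (sub_nonneg.2 (hx z))] at hs
  have := (mul_eq_zero.1 (hs y (Finset.mem_univ y))).resolve_left hn.ne'
  linarith

variable {X₀ X₁ : Set X}

namespace IsDecomposition

lemma mem_right (hD : IsDecomposition P X₀ X₁) {x : X} (hx : ¬ IsInessential P x) : x ∈ X₁ := by
  have : x ∈ X₀ ∪ X₁ := hD.union_eq ▸ Set.mem_univ x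
  exact this.resolve_left fun h => hx (hD.inessential x h)

lemma accessible (hD : IsDecomposition P X₀ X₁) (x : X) {y : X} (hy : y ∈ X₁) :
    Accessible P x y := by
  obtain ⟨z, hxz, hz⟩ := exists_accessible_not_isInessential hD.stochastic x
  exact hxz.trans hD.stochastic (hD.irreducible z (hD.mem_right hz) y hy)

/-- If `y` led to some `z` without return, `z` would still lead to an essential state; that state
lies in `X₁`, hence leads to `x` and on to `y`. -/
lemma mem_right_of_accessible (hD : IsDecomposition P X₀ X₁) {x y : X} (hx : x ∈ X₁)
    (hxy : Accessible P x y) : y ∈ X₁ := by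
  refine hD.mem_right ?_
  rintro ⟨z, hyz, hzy⟩
  obtain ⟨w, hzw, hw⟩ := exists_accessible_not_isInessential hD.stochastic z
  exact hzy ((hzw.trans hD.stochastic (hD.irreducible w (hD.mem_right hw) x hx)).trans
    hD.stochastic hxy)

lemma apply_eq_zero (hD : IsDecomposition P X₀ X₁) {x y : X} (hx : x ∈ X₁) (hy : y ∉ X₁) :
    P x y = 0 := by
  by_contra h
  refine hy (hD.mem_right_of_accessible hx ⟨1, ?_⟩)
  rw [pow_one]
  exact lt_of_le_of_ne (nonneg_of_mem_rowStochastic hD.stochastic) (Ne.symm h)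

/-- A maximum and a minimum of `h` both propagate to one state of `X₁`, which is accessible from
everywhere. -/
lemma harmonic_eq (hD : IsDecomposition P X₀ X₁) {h : X → ℝ} (hh : P *ᵥ h = h) (x y : X) :
    h x = h y := by
  have : Nonempty X := ⟨x⟩
  obtain ⟨z, hz⟩ := hD.nonempty_right
  obtain ⟨a, ha⟩ := Finite.exists_max h
  obtain ⟨b, hb⟩ := Finite.exists_min h
  have h1 := harmonic_eq_of_accessible hD.stochastic hh ha (hD.accessible a hz)
  have h2 := harmonic_eq_of_accessible (h := -h) hD.stochastic (by rw [mulVec_neg, hh])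
    (fun z => by simpa using hb z) (hD.accessible b hz)
  simp only [Pi.neg_apply] at h2
  linarith [ha x, ha y, hb x, hb y]

/-- Solvability of the Poisson equation. -/
lemma exists_poisson (hD : IsDecomposition P X₀ X₁) {w : X → ℝ} (hw : w ᵥ* P = w)
    (hw1 : w ⬝ᵥ 1 = 1) {g : X → ℝ} (hg : w ⬝ᵥ g = 0) :
    ∃ h : X → ℝ, h - P *ᵥ h = g := by
  -- The rank-one term removes the constants from the kernel of `I - P`. Since `L` preserves the
  -- `w`-mean, its kernel consists of harmonic, hence constant, functions of mean zero; injectivity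
  -- gives surjectivity in finite dimension.
  let L : (X → ℝ) →ₗ[ℝ] (X → ℝ) :=
    { toFun := fun h => h - P *ᵥ h + (w ⬝ᵥ h) • 1
      map_add' := fun a b => by simp only [mulVec_add, dotProduct_add, add_smul]; abel
      map_smul' := fun c a => by
        simp only [mulVec_smul, dotProduct_smul, RingHom.id_apply, smul_add, smul_sub, smul_assoc] }
  have hL : ∀ h, w ⬝ᵥ L h = w ⬝ᵥ h := by
    intro h
    change w ⬝ᵥ (h - P *ᵥ h + (w ⬝ᵥ h) • 1) = _
    rw [dotProduct_add, dotProduct_sub, dotProduct_mulVec, hw, dotProduct_smul, hw1]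
    simp
  have hinj : Function.Injective L := by
    rw [← LinearMap.ker_eq_bot, LinearMap.ker_eq_bot']
    intro h hh
    have h0 : w ⬝ᵥ h = 0 := by rw [← hL, hh, dotProduct_zero]
    have hh' : h - P *ᵥ h + (w ⬝ᵥ h) • 1 = 0 := hh
    rw [h0, zero_smul, add_zero, sub_eq_zero] at hh'
    ext x
    have hc : h = h x • 1 := by
      ext y
      simpa using hD.harmonic_eq hh'.symm y x
    rw [hc, dotProduct_smul, hw1] at h0
    simpa using h0
  obtain ⟨h, hh⟩ := (LinearMap.injective_iff_surjective.1 hinj) g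
  have h0 : w ⬝ᵥ h = 0 := by rw [← hL, hh, hg]
  refine ⟨h, ?_⟩
  have hh' : h - P *ᵥ h + (w ⬝ᵥ h) • 1 = g := hh
  rwa [h0, zero_smul, add_zero] at hh'

end IsDecomposition

end Stochastic

/-! ### Convergence along squares and a Borel–Cantelli argument. -/

section Averages

lemma abs_sub_le_of_abs_succ_sub_le {a : ℕ → ℝ} {C : ℝ} (ha : ∀ n, |a (n + 1) - a n| ≤ C)
    (m j : ℕ) : |a (m + j) - a m| ≤ C * j := by
  induction j with
  | zero => simp
  | succ j ih =>
    have := abs_sub_le (a (m + (j + 1))) (a (m + j)) (a m)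
    have h2 := ha (m + j)
    rw [← add_assoc] at *
    push_cast
    linarith

lemma tendsto_natSqrt_atTop : Tendsto Nat.sqrt atTop atTop :=
  tendsto_atTop_atTop.2 fun b => ⟨b * b, fun _ hn => Nat.le_sqrt.2 hn⟩

/-- A sequence with bounded increments is `o(n)` as soon as it is along the squares. -/
lemma tendsto_div_of_tendsto_sq {a : ℕ → ℝ} {C : ℝ} (ha : ∀ n, |a (n + 1) - a n| ≤ C)
    (hsq : Tendsto (fun m : ℕ => a (m ^ 2) / (m : ℝ) ^ 2) atTop (𝓝 0)) :
    Tendsto (fun n : ℕ => a n / n) atTop (𝓝 0) := by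
  have hC : 0 ≤ C := (abs_nonneg _).trans (ha 0)
  have hb : Tendsto (fun m : ℕ => |a (m ^ 2) / (m : ℝ) ^ 2| + 2 * C * (m : ℝ)⁻¹) atTop (𝓝 0) := by
    simpa using hsq.abs.add (tendsto_natCast_atTop_atTop.inv_tendsto_atTop.const_mul (2 * C))
  refine squeeze_zero_norm' ?_ (hb.comp tendsto_natSqrt_atTop)
  filter_upwards [eventually_ge_atTop 1] with n hn
  -- With `m = √n` rounded down, `n = m² + j` and `j ≤ 2m`, so the increments after `m²` contribute
  -- `O(m) = o(m²)`.
  obtain ⟨j, hj⟩ := Nat.exists_eq_add_of_le (Nat.sqrt_le' n)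
  have hm : 1 ≤ n.sqrt := Nat.le_sqrt.2 (by simpa using hn)
  have hj2 : j ≤ 2 * n.sqrt := by
    have := Nat.sqrt_le_add n
    rw [← pow_two] at this
    omega
  simp only [Function.comp_apply, Real.norm_eq_abs]
  set m := n.sqrt with hmdef
  have hm0 : (0 : ℝ) < m := by exact_mod_cast hm
  have hmn : (m : ℝ) ^ 2 ≤ n := by exact_mod_cast Nat.sqrt_le' n
  have h1 : |a n| ≤ |a (m ^ 2)| + C * (2 * m) := by
    have h2 := abs_sub_le_of_abs_succ_sub_le ha (m ^ 2) j
    rw [← hj] at h2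
    have h3 : C * (j : ℝ) ≤ C * (2 * m) := by
      gcongr
      exact_mod_cast hj2
    have h4 := abs_sub_abs_le_abs_sub (a n) (a (m ^ 2))
    linarith
  rw [abs_div, abs_div, Nat.abs_cast, abs_of_pos (pow_pos hm0 2)]
  calc |a n| / n ≤ |a n| / (m : ℝ) ^ 2 := by gcongr
    _ ≤ (|a (m ^ 2)| + C * (2 * m)) / (m : ℝ) ^ 2 := by gcongr
    _ = |a (m ^ 2)| / (m : ℝ) ^ 2 + 2 * C * (m : ℝ)⁻¹ := by field_simp

/-- Nonnegative random variables with summable expectations tend to zero almost surely. -/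
lemma ae_tendsto_zero_of_integral_le {Ω : Type*} [MeasurableSpace Ω] {ℙ : Measure Ω}
    {Z : ℕ → Ω → ℝ} {c : ℕ → ℝ} (hZ0 : ∀ n ω, 0 ≤ Z n ω) (hZ : ∀ n, Integrable (Z n) ℙ)
    (hc : Summable c) (hle : ∀ n, ∫ ω, Z n ω ∂ℙ ≤ c n) :
    ∀ᵐ ω ∂ℙ, Tendsto (fun n => Z n ω) atTop (𝓝 0) := by
  have hm : ∀ n, AEMeasurable (fun ω => ENNReal.ofReal (Z n ω)) ℙ :=
    fun n => (hZ n).aemeasurable.ennreal_ofReal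
  -- By Tonelli the series has finite expectation, so almost surely it converges and its terms tend
  -- to zero.
  have hfin : ∫⁻ ω, ∑' n, ENNReal.ofReal (Z n ω) ∂ℙ ≠ ∞ := by
    rw [lintegral_tsum hm]
    simp_rw [← ofReal_integral_eq_lintegral_ofReal (hZ _) (ae_of_all _ (hZ0 _))]
    refine ne_top_of_le_ne_top hc.tsum_ofReal_ne_top ?_
    exact ENNReal.tsum_le_tsum fun n => ENNReal.ofReal_le_ofReal (hle n)
  filter_upwards [ae_lt_top' (AEMeasurable.tsum hm) hfin] with ω hω
  have := (ENNReal.tendsto_toReal ENNReal.zero_ne_top).comp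
    (ENNReal.tendsto_atTop_zero_of_tsum_ne_top hω.ne)
  simpa [Function.comp_def, ENNReal.toReal_ofReal (hZ0 _ _)] using this

end Averages

/-! ### The law of large numbers through the martingale decomposition. -/

section LawOfLargeNumbers

open Matrix

variable {X Ω : Type*} [Fintype X]

/-- The martingale part `∑_{i < n} (h (x (i + 1)) - P h (x i))` of `h` along the path `x`. -/
def martingalePart (P : Matrix X X ℝ) (h : X → ℝ) (n : ℕ) (x : ℕ → X) : ℝ :=
  ∑ i ∈ Finset.range n, (h (x (i + 1)) - (P *ᵥ h) (x i))

lemma martingalePart_succ (P : Matrix X X ℝ) (h : X → ℝ) (n : ℕ) (x : ℕ → X) :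
    martingalePart P h (n + 1) x = martingalePart P h n x + (h (x (n + 1)) - (P *ᵥ h) (x n)) :=
  Finset.sum_range_succ _ _

lemma dependsOn_martingalePart (P : Matrix X X ℝ) (h : X → ℝ) (n : ℕ) :
    DependsOn (martingalePart P h n) (Set.Iic n) := by
  intro x y hxy
  refine Finset.sum_congr rfl fun i hi => ?_
  have hi := Finset.mem_range.1 hi
  rw [hxy i (Set.mem_Iic.2 (by omega)), hxy (i + 1) (Set.mem_Iic.2 (by omega))]

lemma exists_abs_increment_le (P : Matrix X X ℝ) (h : X → ℝ) :
    ∃ C : ℝ, ∀ x y, |h y - (P *ᵥ h) x| ≤ C := by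
  obtain ⟨C, hC⟩ := (Set.finite_range fun z : X × X => |h z.2 - (P *ᵥ h) z.1|).bddAbove
  exact ⟨C, fun x y => hC ⟨(x, y), rfl⟩⟩

lemma sum_sub_mulVec_eq (P : Matrix X X ℝ) (h : X → ℝ) (n : ℕ) (x : ℕ → X) :
    ∑ i ∈ Finset.range n, (h - P *ᵥ h) (x i) = martingalePart P h n x + (h (x 0) - h (x n)) := by
  induction n with
  | zero => simp [martingalePart]
  | succ n ih =>
    rw [Finset.sum_range_succ, ih, martingalePart_succ, Pi.sub_apply]
    ring

variable [MeasurableSpace X] [MeasurableSpace Ω]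
  {P : Matrix X X ℝ} {Y : ℕ → Ω → X} {ℙ : Measure Ω} [IsProbabilityMeasure ℙ]
  {X₀ X₁ : Set X} {ν : Measure X}

lemma IsStationaryOn.vecMul_eq (hν : IsStationaryOn P X₁ ν) :
    (fun x => ν.real {x}) ᵥ* P = fun x => ν.real {x} :=
  funext hν.stationary

variable [MeasurableSingletonClass X]

/-- When the square is expanded, the cross term has mean zero by the Markov property, and each new
increment adds at most `C ^ 2`. -/
lemma IsMarkovChain.integral_martingalePart_sq_le (hY : IsMarkovChain P Y ℙ) {h : X → ℝ} {C : ℝ}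
    (hC : ∀ x y, |h y - (P *ᵥ h) x| ≤ C) (n : ℕ) :
    ∫ ω, martingalePart P h n (fun i => Y i ω) ^ 2 ∂ℙ ≤ C ^ 2 * n := by
  induction n with
  | zero => simp [martingalePart]
  | succ n ih =>
    have hM := dependsOn_martingalePart P h n
    have i1 : Integrable (fun ω => martingalePart P h n (fun i => Y i ω) ^ 2) ℙ :=
      integrable_of_dependsOn (n := n) (F := fun x => martingalePart P h n x ^ 2)
        (fun x y hxy => by simp only [hM hxy]) hY.measurable ℙ
    have i2 : Integrable (fun ω => martingalePart P h n (fun i => Y i ω) * h (Y (n + 1) ω)) ℙ :=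
      integrable_of_dependsOn (n := n + 1) (F := fun x => martingalePart P h n x * h (x (n + 1)))
        (fun x y hxy => by
          simp only [hM fun i (hi : i ≤ n) => hxy i (Set.mem_Iic.2 (by omega)),
            hxy (n + 1) (Set.mem_Iic.2 le_rfl)]) hY.measurable ℙ
    have i3 : Integrable (fun ω => martingalePart P h n (fun i => Y i ω) * (P *ᵥ h) (Y n ω)) ℙ :=
      integrable_of_dependsOn (n := n) (F := fun x => martingalePart P h n x * (P *ᵥ h) (x n))
        (fun x y hxy => by simp only [hM hxy, hxy n (Set.mem_Iic.2 le_rfl)]) hY.measurable ℙ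
    have hi := hY.integral_mul_next hM h
    have hle : ∀ ω, martingalePart P h (n + 1) (fun i => Y i ω) ^ 2
        ≤ martingalePart P h n (fun i => Y i ω) ^ 2
          + 2 * (martingalePart P h n (fun i => Y i ω) * h (Y (n + 1) ω)
            - martingalePart P h n (fun i => Y i ω) * (P *ᵥ h) (Y n ω)) + C ^ 2 := by
      intro ω
      rw [martingalePart_succ]
      have := sq_le_sq' (abs_le.1 (hC (Y n ω) (Y (n + 1) ω))).1
        (abs_le.1 (hC (Y n ω) (Y (n + 1) ω))).2
      linarith
    have i4 : Integrable (fun ω => 2 * (martingalePart P h n (fun i => Y i ω) * h (Y (n + 1) ω)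
        - martingalePart P h n (fun i => Y i ω) * (P *ᵥ h) (Y n ω))) ℙ := (i2.sub i3).const_mul 2
    have i5 : Integrable (fun ω => martingalePart P h n (fun i => Y i ω) ^ 2
        + 2 * (martingalePart P h n (fun i => Y i ω) * h (Y (n + 1) ω)
          - martingalePart P h n (fun i => Y i ω) * (P *ᵥ h) (Y n ω))) ℙ := i1.add i4
    calc _ ≤ ∫ ω, (martingalePart P h n (fun i => Y i ω) ^ 2
          + 2 * (martingalePart P h n (fun i => Y i ω) * h (Y (n + 1) ω)
            - martingalePart P h n (fun i => Y i ω) * (P *ᵥ h) (Y n ω)) + C ^ 2) ∂ℙ :=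
          integral_mono_of_nonneg (ae_of_all _ fun ω => sq_nonneg _)
            (i5.add (integrable_const _)) (ae_of_all _ hle)
      _ = ∫ ω, martingalePart P h n (fun i => Y i ω) ^ 2 ∂ℙ + C ^ 2 := by
          rw [integral_add i5 (integrable_const _), integral_add i1 i4,
            integral_const_mul, integral_sub i2 i3, hi]
          simp
      _ ≤ C ^ 2 * (n + 1 : ℕ) := by
          push_cast
          linarith

/-- At time `m ^ 2` the normalized second moment is at most `C ^ 2 / m ^ 2`, which is summable;
bounded increments fill the gaps between squares. -/
lemma IsMarkovChain.ae_tendsto_martingalePart_div (hY : IsMarkovChain P Y ℙ) (h : X → ℝ) :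
    ∀ᵐ ω ∂ℙ, Tendsto (fun n : ℕ => martingalePart P h n (fun i => Y i ω) / n) atTop (𝓝 0) := by
  obtain ⟨C, hC⟩ := exists_abs_increment_le P h
  have key : ∀ᵐ ω ∂ℙ, Tendsto (fun m : ℕ =>
      (martingalePart P h (m ^ 2) (fun i => Y i ω) / (m : ℝ) ^ 2) ^ 2) atTop (𝓝 0) := by
    refine ae_tendsto_zero_of_integral_le (c := fun m : ℕ => C ^ 2 * (1 / (m : ℝ) ^ 2))
      (fun _ _ => sq_nonneg _) (fun m => ?_)
      ((Real.summable_one_div_nat_pow.2 one_lt_two).mul_left _) (fun m => ?_)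
    · exact integrable_of_dependsOn (n := m ^ 2)
        (F := fun x => (martingalePart P h (m ^ 2) x / (m : ℝ) ^ 2) ^ 2)
        (fun x y hxy => by simp only [dependsOn_martingalePart P h (m ^ 2) hxy]) hY.measurable ℙ
    · have := hY.integral_martingalePart_sq_le hC (m ^ 2)
      simp_rw [div_pow, integral_div]
      rcases Nat.eq_zero_or_pos m with rfl | hm
      · simp
      have hm0 : (0 : ℝ) < m := by exact_mod_cast hm
      rw [div_le_iff₀ (by positivity)]
      refine this.trans_eq ?_
      push_cast
      field_simp
  filter_upwards [key] with ω hω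
  refine tendsto_div_of_tendsto_sq (C := C) (fun n => ?_) ?_
  · rw [martingalePart_succ, add_sub_cancel_left]
    exact hC _ _
  · have := hω.sqrt
    simp only [Real.sqrt_sq_eq_abs, Real.sqrt_zero] at this
    exact (tendsto_zero_iff_abs_tendsto_zero _).2 this

lemma IsStationaryOn.dotProduct_one (hν : IsStationaryOn P X₁ ν) :
    (fun x => ν.real {x}) ⬝ᵥ (1 : X → ℝ) = 1 := by
  have := hν.probability
  simp [dotProduct]

variable [DecidableEq X]

/-- The law of large numbers for the chain. -/
lemma IsMarkovChain.ae_tendsto_average (hY : IsMarkovChain P Y ℙ)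
    (hD : IsDecomposition P X₀ X₁) (hν : IsStationaryOn P X₁ ν) (g : X → ℝ) :
    ∀ᵐ ω ∂ℙ, Tendsto (fun n : ℕ => (∑ i ∈ Finset.range n, g (Y i ω)) / n) atTop
      (𝓝 (∑ x, ν.real {x} * g x)) := by
  set c := ∑ x, ν.real {x} * g x with hc
  have h0 : (fun x => ν.real {x}) ⬝ᵥ (g - c • 1) = 0 := by
    rw [dotProduct_sub, dotProduct_smul, hν.dotProduct_one]
    simp [dotProduct, hc]
  obtain ⟨h, hh⟩ := hD.exists_poisson hν.vecMul_eq hν.dotProduct_one h0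
  obtain ⟨C, hC⟩ := (Set.finite_range fun z : X × X => |h z.1 - h z.2|).bddAbove
  filter_upwards [hY.ae_tendsto_martingalePart_div h] with ω hω
  have hb : Tendsto (fun n : ℕ => (h (Y 0 ω) - h (Y n ω)) / n) atTop (𝓝 0) := by
    refine squeeze_zero_norm (fun n => ?_)
      (by simpa using tendsto_natCast_atTop_atTop.inv_tendsto_atTop.const_mul C)
    rw [norm_div, Real.norm_eq_abs, Real.norm_natCast, div_eq_mul_inv]
    exact mul_le_mul_of_nonneg_right (hC ⟨(Y 0 ω, Y n ω), rfl⟩) (by positivity)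
  have := (hω.add hb).add_const c
  simp only [zero_add] at this
  refine this.congr' ?_
  filter_upwards [eventually_ge_atTop 1] with n hn
  have hn0 : (n : ℝ) ≠ 0 := by positivity
  have hs := sum_sub_mulVec_eq P h n fun i => Y i ω
  rw [hh] at hs
  simp only [Pi.sub_apply, Pi.smul_apply, Pi.one_apply, smul_eq_mul, mul_one,
    Finset.sum_sub_distrib, Finset.sum_const, Finset.card_range, nsmul_eq_mul] at hs
  rw [← add_div, ← hs]
  field_simp
  ring

end LawOfLargeNumbers

/-! ### Medoids on a finite space and their stability. -/

section FiniteMedoids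

variable {X : Type*} [MetricSpace X] [MeasurableSpace X]

lemma mem_support_iff_measure_singleton_pos [Finite X] {μ : Measure X} {x : X} :
    x ∈ μ.support ↔ 0 < μ {x} := by
  rw [Measure.mem_support_iff_forall]
  have hx : {x} ∈ 𝓝 x := by simp [nhds_discrete]
  exact ⟨fun h => h _ hx, fun h U hU =>
    h.trans_le (measure_mono (Set.singleton_subset_iff.2 (mem_of_mem_nhds hU)))⟩

lemma mem_support_iff_real_singleton_pos [Finite X] {μ : Measure X} [IsFiniteMeasure μ] {x : X} :
    x ∈ μ.support ↔ 0 < μ.real {x} := by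
  rw [mem_support_iff_measure_singleton_pos, measureReal_def,
    ENNReal.toReal_pos_iff, and_iff_left (measure_lt_top _ _)]

lemma feasible_nonempty {α : Type*} {k : ℕ} (hk : 1 ≤ k) {R : Set α} (hR : R.Nonempty) :
    (feasible k R).Nonempty := by
  obtain ⟨x, hx⟩ := hR
  exact ⟨{x}, by simpa using hx, by simp, by simpa using hk⟩

lemma medoids_nonempty [Finite X] {k : ℕ} (hk : 1 ≤ k) (p : ℝ) {μ : Measure X}
    (hμ : μ.support.Nonempty) : (medoids k p μ).Nonempty := by
  obtain ⟨S, hS, hmin⟩ := Set.exists_min_image (feasible k μ.support) (loss p μ)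
    (Set.toFinite _) (feasible_nonempty hk hμ)
  exact ⟨S, hS, hmin⟩

lemma maxMinHausdorff_eq_zero_of_subset {Z : Type*} [MetricSpace Z] {C D : Set (Set Z)}
    (h : C ⊆ D) :
    maxMinHausdorff C D = 0 := by
  simp only [maxMinHausdorff, ENNReal.iSup_eq_zero]
  intro S hS
  refine le_antisymm ?_ bot_le
  exact (iInf₂_le S (h hS)).trans_eq Metric.hausdorffEDist_self

variable [Fintype X] [MeasurableSingletonClass X]

lemma loss_eq_sum (p : ℝ) (μ : Measure X) [IsFiniteMeasure μ] (S : Set X) :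
    loss p μ S = ∑ y, μ.real {y} * Metric.infDist y S ^ p := by
  rw [loss, integral_fintype .of_finite]
  simp

/-- If finite measures converge on a finite space and their supports are eventually the support of
the limit, then eventually all medoids are medoids of the limit. -/
lemma eventually_medoids_subset {k : ℕ} {p : ℝ} {μ : ℕ → Measure X} [∀ n, IsFiniteMeasure (μ n)]
    {ν : Measure X} [IsFiniteMeasure ν]
    (hμ : ∀ x, Tendsto (fun n => (μ n).real {x}) atTop (𝓝 (ν.real {x})))
    (hsupp : ∀ᶠ n in atTop, (μ n).support = ν.support) :
    ∀ᶠ n in atTop, medoids k p (μ n) ⊆ medoids k p ν := by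
  have hloss : ∀ S, Tendsto (fun n => loss p (μ n) S) atTop (𝓝 (loss p ν S)) := by
    intro S
    simp_rw [loss_eq_sum]
    exact tendsto_finsetSum _ fun x _ => (hμ x).mul_const _
  have hlt : ∀ S T, ∀ᶠ n in atTop, loss p ν T < loss p ν S → loss p (μ n) T < loss p (μ n) S := by
    intro S T
    by_cases h : loss p ν T < loss p ν S
    · filter_upwards [(hloss T).eventually_lt (hloss S) h] with n hn _ using hn
    · exact .of_forall fun n h' => absurd h' h
  -- One threshold serves all pairs because `X` has finitely many subsets.
  have hall : ∀ᶠ n in atTop, ∀ S T,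
      loss p ν T < loss p ν S → loss p (μ n) T < loss p (μ n) S :=
    eventually_all.2 fun S => eventually_all.2 fun T => hlt S T
  filter_upwards [hall, hsupp] with n hn hs S hS
  rw [medoids, hs] at hS
  refine ⟨hS.1, fun T hT => ?_⟩
  by_contra h
  exact (hS.2 hT).not_gt (hn S T (not_le.1 h))

end FiniteMedoids

/-! ### Empirical measures and their frequencies. -/

section Empirical

variable {X : Type*} [MeasurableSpace X]

instance isFiniteMeasure_empiricalMeasure (y : ℕ → X) (a b : ℕ) :
    IsFiniteMeasure (empiricalMeasure y a b) := by
  -- For an empty sample the factor is `0⁻¹ = ∞`, but it multiplies the zero measure.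
  rcases Nat.eq_zero_or_pos (b - a) with h | h
  · have h0 : empiricalMeasure y a b = 0 := by
      rw [empiricalMeasure, Finset.Ico_eq_empty (by omega)]
      simp
    rw [h0]
    infer_instance
  · refine ⟨?_⟩
    have : (((b - a : ℕ) : ℝ≥0∞))⁻¹ ≠ ∞ := ENNReal.inv_ne_top.2 (by exact_mod_cast h.ne')
    simp only [empiricalMeasure, Measure.smul_apply, smul_eq_mul]
    exact ENNReal.mul_lt_top this.lt_top (measure_lt_top _ _)

variable [MeasurableSingletonClass X] [DecidableEq X]

lemma empiricalMeasure_real_singleton (y : ℕ → X) (a b : ℕ) (x : X) :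
    (empiricalMeasure y a b).real {x}
      = (∑ i ∈ Finset.Ico a b, if y i = x then (1 : ℝ) else 0) / (b - a : ℕ) := by
  rw [empiricalMeasure, measureReal_ennreal_smul_apply, div_eq_inv_mul]
  congr 1
  · rw [ENNReal.toReal_inv, ENNReal.toReal_natCast]
  · rw [measureReal_def, Measure.finsetSum_apply, ENNReal.toReal_sum fun _ _ => measure_ne_top _ _]
    refine Finset.sum_congr rfl fun i _ => ?_
    rw [Measure.dirac_apply' _ (measurableSet_singleton x)]
    simp [Set.indicator_apply, apply_ite ENNReal.toReal]

/-- Forgetting `f n = o(n)` of the first `n` data points does not change limiting frequencies. -/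
lemma tendsto_empiricalMeasure_real {y : ℕ → X} {x : X} {c : ℝ}
    (hc : Tendsto (fun n : ℕ => (∑ i ∈ Finset.range n, if y i = x then (1 : ℝ) else 0) / n) atTop
      (𝓝 c)) {f : ℕ → ℕ} (hf : ∀ n, f n ≤ n)
    (hfn : Tendsto (fun n => (f n : ℝ) / (n : ℝ)) atTop (𝓝 0)) :
    Tendsto (fun n => (empiricalMeasure y (f n) n).real {x}) atTop (𝓝 c) := by
  set N : ℕ → ℝ := fun n => ∑ i ∈ Finset.range n, if y i = x then (1 : ℝ) else 0 with hN
  have hN0 : ∀ n, 0 ≤ N n := fun n => Finset.sum_nonneg fun i _ => by split_ifs <;> simp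
  have hNle : ∀ n, N n ≤ n := fun n => by
    refine (Finset.sum_le_sum (g := fun _ => (1 : ℝ)) fun i _ => ?_).trans_eq (by simp)
    split_ifs <;> simp
  have hNf : Tendsto (fun n => N (f n) / n) atTop (𝓝 0) :=
    squeeze_zero (fun n => div_nonneg (hN0 _) (Nat.cast_nonneg _))
      (fun n => div_le_div_of_nonneg_right (hNle (f n)) (Nat.cast_nonneg _)) hfn
  -- The frequency after burn-in is `(N n - N (f n)) / (n - f n)`; numerator and denominator are
  -- divided by `n`.
  have h1 : Tendsto (fun n : ℕ => (N n / n - N (f n) / n) / (1 - (f n : ℝ) / n)) atTop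
      (𝓝 ((c - 0) / (1 - 0))) :=
    (hc.sub hNf).div (tendsto_const_nhds.sub hfn) (by norm_num)
  simp only [sub_zero, div_one] at h1
  refine h1.congr' ?_
  filter_upwards [eventually_ge_atTop 1] with n hn
  have hn0 : (n : ℝ) ≠ 0 := by positivity
  rw [empiricalMeasure_real_singleton, Finset.sum_Ico_eq_sub _ (hf n), Nat.cast_sub (hf n),
    ← sub_div, one_sub_div hn0, div_div_div_cancel_right₀ hn0]

end Empirical

/-! ### Support of the stationary law and absorption in `X₁`. -/

section Support

variable {X Ω : Type*} [Fintype X] [MeasurableSpace X]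
  {P : Matrix X X ℝ} {X₀ X₁ : Set X} {ν : Measure X}

lemma IsStationaryOn.real_singleton_eq_zero (hν : IsStationaryOn P X₁ ν) {x : X} (hx : x ∉ X₁) :
    ν.real {x} = 0 := by
  rw [measureReal_def, measure_mono_null (Set.singleton_subset_iff.2 hx) hν.carried]
  rfl

variable [DecidableEq X] [MeasurableSingletonClass X]

/-- Some state has positive mass and leads to `x`; invariance under the powers of `P` carries mass
from it to `x`. -/
lemma IsStationaryOn.real_singleton_pos (hν : IsStationaryOn P X₁ ν)
    (hD : IsDecomposition P X₀ X₁) {x : X} (hx : x ∈ X₁) : 0 < ν.real {x} := by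
  have := hν.probability
  have hpow : ∀ n, Matrix.vecMul (fun x => ν.real {x}) (P ^ n) = fun x => ν.real {x} := by
    intro n
    induction n with
    | zero => simp
    | succ n ih => rw [pow_succ, ← Matrix.vecMul_vecMul, ih, hν.vecMul_eq]
  obtain ⟨z, hz⟩ : ∃ z, 0 < ν.real {z} := by
    by_contra! h
    have h1 := hν.dotProduct_one
    have h0 : (fun x => ν.real {x}) = 0 :=
      funext fun z => le_antisymm (h z) measureReal_nonneg
    rw [h0, zero_dotProduct] at h1
    exact zero_ne_one h1
  obtain ⟨n, hn⟩ := hD.accessible z hx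
  have h1 := congrFun (hpow n) x
  simp only [Matrix.vecMul, dotProduct] at h1
  rw [← h1]
  exact (mul_pos hz hn).trans_le <| Finset.single_le_sum
    (f := fun w => ν.real {w} * (P ^ n) w x) (fun w _ => mul_nonneg measureReal_nonneg
    (pow_nonneg_of_mem_rowStochastic hD.stochastic _ _ _)) (Finset.mem_univ z)

variable [MeasurableSpace Ω] {Y : ℕ → Ω → X} {ℙ : Measure Ω} [IsProbabilityMeasure ℙ]

/-- Once in `X₁`, the chain never leaves it. -/
lemma IsMarkovChain.ae_mem_right_succ (hY : IsMarkovChain P Y ℙ)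
    (hD : IsDecomposition P X₀ X₁) : ∀ᵐ ω ∂ℙ, ∀ n, Y n ω ∈ X₁ → Y (n + 1) ω ∈ X₁ := by
  classical
  rw [ae_all_iff]
  intro n
  -- `F * h` is the indicator of leaving `X₁` at this step; its mean is zero since `P h` vanishes on
  -- `X₁`.
  let F : (ℕ → X) → ℝ := fun x => if x n ∈ X₁ then 1 else 0
  let h : X → ℝ := fun x => if x ∈ X₁ then 0 else 1
  have hF : DependsOn F (Set.Iic n) := fun x y hxy => by
    simp only [F, hxy n (Set.mem_Iic.2 le_rfl)]
  have hint : Integrable (fun ω => F (fun i => Y i ω) * h (Y (n + 1) ω)) ℙ :=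
    integrable_of_dependsOn (n := n + 1) (F := fun x => F x * h (x (n + 1)))
      (fun x y hxy => by
        simp only [hF fun i (hi : i ≤ n) => hxy i (Set.mem_Iic.2 (by omega)),
          hxy (n + 1) (Set.mem_Iic.2 le_rfl)]) hY.measurable ℙ
  have h0 : ∫ ω, F (fun i => Y i ω) * h (Y (n + 1) ω) ∂ℙ = 0 := by
    rw [hY.integral_mul_next hF]
    refine integral_eq_zero_of_ae (.of_forall fun ω => ?_)
    by_cases hx : Y n ω ∈ X₁
    · have : P.mulVec h (Y n ω) = 0 := by
        refine Finset.sum_eq_zero fun y _ => ?_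
        by_cases hy : y ∈ X₁
        · simp [h, hy]
        · simp [hD.apply_eq_zero hx hy]
      simp [this]
    · simp [F, hx]
  rw [integral_eq_zero_iff_of_nonneg (fun ω => by simp only [F, h]; split_ifs <;> simp) hint] at h0
  filter_upwards [h0] with ω hω hx
  by_contra hx'
  simp [F, h, hx, hx'] at hω

lemma IsMarkovChain.ae_tendsto_frequency (hY : IsMarkovChain P Y ℙ)
    (hD : IsDecomposition P X₀ X₁) (hν : IsStationaryOn P X₁ ν) :
    ∀ᵐ ω ∂ℙ, ∀ x, Tendsto (fun n : ℕ =>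
      (∑ i ∈ Finset.range n, if Y i ω = x then (1 : ℝ) else 0) / n) atTop (𝓝 (ν.real {x})) := by
  rw [ae_all_iff]
  intro x
  filter_upwards [hY.ae_tendsto_average hD hν fun z => if z = x then 1 else 0] with ω hω
  simpa using hω

/-- The chain is eventually in `X₁`. -/
lemma IsMarkovChain.ae_eventually_mem_right (hY : IsMarkovChain P Y ℙ)
    (hD : IsDecomposition P X₀ X₁) (hν : IsStationaryOn P X₁ ν) :
    ∀ᵐ ω ∂ℙ, ∀ᶠ n in atTop, Y n ω ∈ X₁ := by
  filter_upwards [hY.ae_tendsto_frequency hD hν, hY.ae_mem_right_succ hD] with ω hω hstay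
  obtain ⟨x, hx⟩ := hD.nonempty_right
  -- A path that avoids `X₁` would give `x` frequency zero, against the positive limit `ν {x}`.
  obtain ⟨m, hm⟩ : ∃ m, Y m ω ∈ X₁ := by
    by_contra! h
    have h0 : ∀ i, Y i ω ≠ x := fun i hi => h i (hi ▸ hx)
    have := hω x
    simp only [h0, if_false, Finset.sum_const_zero, zero_div] at this
    exact (hν.real_singleton_pos hD hx).ne (tendsto_nhds_unique tendsto_const_nhds this)
  filter_upwards [eventually_ge_atTop m] with n hn
  induction n, hn using Nat.le_induction with
  | base => exact hm
  | succ n _ ih => exact hstay n ih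

end Support

/-! ### Consistency with burn-in. -/

section Consistency

variable {X Ω : Type*} [MetricSpace X] [Fintype X] [DecidableEq X] [MeasurableSpace X]
  [MeasurableSingletonClass X] [MeasurableSpace Ω]
  {P : Matrix X X ℝ} {X₀ X₁ : Set X} {ν : Measure X} {Y : ℕ → Ω → X} {ℙ : Measure Ω}
  [IsProbabilityMeasure ℙ]

lemma IsStationaryOn.support_eq (hν : IsStationaryOn P X₁ ν) (hD : IsDecomposition P X₀ X₁) :
    ν.support = X₁ := by
  have := hν.probability
  ext x
  rw [mem_support_iff_real_singleton_pos]
  refine ⟨fun h => ?_, hν.real_singleton_pos hD⟩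
  by_contra hx
  exact h.ne' (hν.real_singleton_eq_zero hx)

/-- Strong consistency of medoids with burn-in. -/
theorem IsMarkovChain.ae_medoids_consistent (hY : IsMarkovChain P Y ℙ)
    (hD : IsDecomposition P X₀ X₁) (hν : IsStationaryOn P X₁ ν) {f : ℕ → ℕ} (hf : ∀ n, f n ≤ n)
    (hf' : Tendsto f atTop atTop)
    (hfn : Tendsto (fun n => (f n : ℝ) / (n : ℝ)) atTop (𝓝 0)) {k : ℕ} (hk : 1 ≤ k) (p : ℝ) :
    ∀ᵐ ω ∂ℙ,
      (∀ᶠ n in atTop, (medoids k p (empiricalMeasure (fun i => Y i ω) (f n) n)).Nonempty) ∧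
      Tendsto (fun n => maxMinHausdorff
          (medoids k p (empiricalMeasure (fun i => Y i ω) (f n) n)) (medoids k p ν))
        atTop (𝓝 0) := by
  have := hν.probability
  filter_upwards [hY.ae_tendsto_frequency hD hν, hY.ae_eventually_mem_right hD hν] with ω hω hev
  have hlim : ∀ x, Tendsto (fun n => (empiricalMeasure (fun i => Y i ω) (f n) n).real {x}) atTop
      (𝓝 (ν.real {x})) := fun x => tendsto_empiricalMeasure_real (hω x) hf hfn
  -- Positive limiting frequencies put `X₁` inside the support; absorption and `f n → ∞` leave no
  -- other point in the sample.
  have hsupp : ∀ᶠ n in atTop,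
      (empiricalMeasure (fun i => Y i ω) (f n) n).support = ν.support := by
    have hpos : ∀ᶠ n in atTop, ∀ x ∈ X₁,
        0 < (empiricalMeasure (fun i => Y i ω) (f n) n).real {x} :=
      eventually_all.2 fun x => by
        by_cases hx : x ∈ X₁
        · filter_upwards [(hlim x).eventually_const_lt (hν.real_singleton_pos hD hx)] with n hn _
            using hn
        · exact .of_forall fun n h => absurd h hx
    filter_upwards [hpos, hf'.eventually (eventually_forall_ge_atTop.2 hev)] with n hn hge
    rw [hν.support_eq hD]
    ext x
    rw [mem_support_iff_real_singleton_pos]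
    refine ⟨fun h => ?_, hn x⟩
    by_contra hx
    rw [empiricalMeasure_real_singleton, Finset.sum_eq_zero, zero_div] at h
    · exact h.ne rfl
    · intro i hi
      exact if_neg fun (h : Y i ω = x) => hx (h ▸ hge i (Finset.mem_Ico.1 hi).1)
  constructor
  · filter_upwards [hsupp] with n hn
    refine medoids_nonempty hk p ?_
    rw [hn, hν.support_eq hD]
    exact hD.nonempty_right
  · refine tendsto_const_nhds.congr' ?_
    filter_upwards [eventually_medoids_subset (k := k) (p := p) hlim hsupp] with n hn
    exact (maxMinHausdorff_eq_zero_of_subset hn).symm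

end Consistency

/-! ### Additive martingales and zeros of integer paths. -/

section Recurrence

open Matrix

variable {X Ω : Type*} [Fintype X] [MeasurableSpace X] [MeasurableSingletonClass X]
  [MeasurableSpace Ω]

/-- The filtration generated by the process `Y`. -/
def historyFiltration {Y : ℕ → Ω → X} (hY : ∀ n, Measurable (Y n)) :
    Filtration ℕ (inferInstance : MeasurableSpace Ω) where
  seq n := MeasurableSpace.comap (history Y n) ⊤
  mono' := by
    rintro m n hmn s ⟨A, -, rfl⟩
    exact ⟨{a | (fun i : Fin (m + 1) => a ⟨i, by omega⟩) ∈ A}, trivial, rfl⟩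
  le' := by
    rintro n s ⟨A, -, rfl⟩
    exact measurable_history hY n A.toFinite.measurableSet

variable {P : Matrix X X ℝ} {Y : ℕ → Ω → X} {ℙ : Measure Ω} [IsProbabilityMeasure ℙ]

lemma dependsOn_sum_range {α : Type*} (g : α → ℝ) (n : ℕ) :
    DependsOn (fun x : ℕ → α => ∑ i ∈ Finset.range (n + 1), g (x i)) (Set.Iic n) := by
  intro x y hxy
  refine Finset.sum_congr rfl fun i hi => ?_
  rw [hxy i (Set.mem_Iic.2 (Nat.lt_succ_iff.1 (Finset.mem_range.1 hi)))]

/-- If `P g = 0`, then the partial sums of `g` along the chain form a martingale. -/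
lemma IsMarkovChain.martingale_sum (hY : IsMarkovChain P Y ℙ) {g : X → ℝ} (hg : P *ᵥ g = 0) :
    Martingale (fun n ω => ∑ i ∈ Finset.range (n + 1), g (Y i ω))
      (historyFiltration hY.measurable) ℙ := by
  have hint : ∀ n, Integrable (fun ω => ∑ i ∈ Finset.range (n + 1), g (Y i ω)) ℙ :=
    fun n => integrable_of_dependsOn (dependsOn_sum_range g n) hY.measurable ℙ
  refine martingale_of_setIntegral_eq_succ (fun n => ?_) hint ?_
  · refine Measurable.stronglyMeasurable fun s _ =>
      ⟨(fun a => ∑ i ∈ Finset.range (n + 1), g (extendPath a i)) ⁻¹' s, trivial, ?_⟩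
    ext ω
    simp only [Set.mem_preimage]
    rw [← eq_extendPath_history_of_dependsOn (dependsOn_sum_range g n) Y ω]
  · rintro n s ⟨A, -, rfl⟩
    classical
    have hA : MeasurableSet (history Y n ⁻¹' A) :=
      measurable_history hY.measurable n A.toFinite.measurableSet
    have hgint : Integrable (fun ω => g (Y (n + 1) ω)) ℙ :=
      integrable_of_dependsOn (n := n + 1) (F := fun x => g (x (n + 1)))
        (fun x y hxy => by simp only [hxy (n + 1) (Set.mem_Iic.2 le_rfl)]) hY.measurable ℙ
    simp_rw [Finset.sum_range_succ _ (n + 1)]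
    rw [integral_add (hint n).integrableOn hgint.integrableOn, left_eq_add,
      ← integral_indicator hA]
    -- The indicator of the past event is a functional of the history, so the Markov property
    -- replaces the next `g` by `P g = 0`.
    let F : (ℕ → X) → ℝ := fun x => if (fun i : Fin (n + 1) => x i) ∈ A then 1 else 0
    have hF : DependsOn F (Set.Iic n) := fun x y hxy => by
      have : (fun i : Fin (n + 1) => x i) = fun i : Fin (n + 1) => y i :=
        funext fun i => hxy i (Set.mem_Iic.2 (Nat.lt_succ_iff.1 i.2))
      simp only [F, this]
    have := hY.integral_mul_next hF g
    rw [hg] at this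
    simp only [Pi.zero_apply, mul_zero, integral_zero] at this
    rw [← this]
    congr 1
    ext ω
    have : (fun i : Fin (n + 1) => Y i ω) = history Y n ω := rfl
    simp [Set.indicator_apply, F, this]

/-- An integer path with steps at most `1` cannot change sign without visiting `0`; after a last
zero it would be bounded on one side. -/
lemma frequently_eq_zero_of_not_bdd {s : ℕ → ℤ} (hs : ∀ n, |s (n + 1) - s n| ≤ 1)
    (ha : ¬ BddAbove (Set.range s)) (hb : ¬ BddBelow (Set.range s)) : ∃ᶠ n in atTop, s n = 0 := by
  intro h
  obtain ⟨N, hN⟩ := eventually_atTop.1 h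
  rcases lt_or_gt_of_ne (hN N le_rfl) with h0 | h0
  · refine ha (IsBoundedUnder.bddAbove_range ⟨0, ?_⟩)
    rw [eventually_map]
    filter_upwards [eventually_ge_atTop N] with n hn
    refine le_of_lt ?_
    induction n, hn using Nat.le_induction with
    | base => exact h0
    | succ n hn ih =>
      have h1 := abs_le.1 (hs n)
      have h2 := hN (n + 1) (by omega)
      omega
  · refine hb (IsBoundedUnder.bddBelow_range ⟨0, ?_⟩)
    rw [eventually_map]
    filter_upwards [eventually_ge_atTop N] with n hn
    refine le_of_lt ?_
    induction n, hn using Nat.le_induction with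
    | base => exact h0
    | succ n hn ih =>
      have h1 := abs_le.1 (hs n)
      have h2 := hN (n + 1) (by omega)
      omega

end Recurrence

/-! ### The three-point counterexample. -/

section ThreePointChain

open Matrix

lemma sum_threePoint (f : ThreePoint → ℝ) : ∑ x, f x = f negOne + f zero + f one := by
  have : (Finset.univ : Finset ThreePoint) = {negOne, zero, one} := by decide
  rw [this, Finset.sum_insert (by decide), Finset.sum_insert (by decide), Finset.sum_singleton]
  ring

lemma threePoint_cases (x : ThreePoint) : x = negOne ∨ x = zero ∨ x = one := by
  revert x
  decide

@[simp] lemma coe_negOne : (negOne : ℤ) = -1 := rfl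

@[simp] lemma coe_zero : (zero : ℤ) = 0 := rfl

@[simp] lemma coe_one : (one : ℤ) = 1 := rfl

lemma negOne_ne_zero : negOne ≠ zero := by decide

lemma point_one_ne_zero : one ≠ zero := by decide

lemma negOne_ne_one : negOne ≠ one := by decide

lemma threePointMatrix_mem_rowStochastic : threePointMatrix ∈ rowStochastic ℝ ThreePoint := by
  rw [mem_rowStochastic_iff_sum]
  refine ⟨fun i j => ?_, fun i => ?_⟩
  · simp only [threePointMatrix, of_apply]
    split_ifs <;> norm_num
  · rw [sum_threePoint]
    simp only [threePointMatrix, of_apply, negOne_ne_zero, point_one_ne_zero, if_false, if_true]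
    split_ifs <;> norm_num

lemma threePointMatrix_pow_apply_zero (n : ℕ) {x : ThreePoint} (hx : x ≠ zero) :
    (threePointMatrix ^ n) x zero = 0 := by
  induction n generalizing x with
  | zero => simp [hx]
  | succ n ih =>
    rw [pow_succ', mul_apply, sum_threePoint, ih negOne_ne_zero, ih point_one_ne_zero]
    simp [threePointMatrix, hx]

lemma threePointMatrix_apply_pos (x : ThreePoint) {y : ThreePoint} (hy : y ≠ zero) :
    0 < threePointMatrix x y := by
  simp only [threePointMatrix, of_apply, hy, if_false]
  split_ifs <;> norm_num

theorem isDecomposition_threePointMatrix :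
    IsDecomposition threePointMatrix {zero} {negOne, one} where
  stochastic := threePointMatrix_mem_rowStochastic
  disjoint := by simp [negOne_ne_zero.symm, point_one_ne_zero.symm]
  union_eq := by
    ext x
    rcases threePoint_cases x with rfl | rfl | rfl <;> simp
  nonempty_left := ⟨zero, rfl⟩
  nonempty_right := ⟨one, by simp⟩
  inessential := by
    rintro x rfl
    refine ⟨one, ⟨1, by simpa using threePointMatrix_apply_pos zero point_one_ne_zero⟩, ?_⟩
    rintro ⟨n, hn⟩
    exact hn.ne' (threePointMatrix_pow_apply_zero n point_one_ne_zero)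
  irreducible := by
    intro x _ y hy
    have hy : y ≠ zero := by
      rcases hy with rfl | rfl
      exacts [negOne_ne_zero, point_one_ne_zero]
    exact ⟨1, by simpa using threePointMatrix_apply_pos x hy⟩
  aperiodic := by
    intro x hx d hd
    have hx : x ≠ zero := by
      rcases hx with rfl | rfl
      exacts [negOne_ne_zero, point_one_ne_zero]
    exact Nat.dvd_one.1 (hd 1 le_rfl (by simpa using threePointMatrix_apply_pos x hx))

lemma signLaw_singleton (x : ThreePoint) : signLaw {x} = if x = zero then 0 else 2⁻¹ := by
  rcases threePoint_cases x with rfl | rfl | rfl <;>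
    simp [signLaw, negOne_ne_zero, point_one_ne_zero, negOne_ne_one, negOne_ne_one.symm]

lemma signLaw_real_singleton (x : ThreePoint) :
    signLaw.real {x} = if x = zero then 0 else 1 / 2 := by
  rw [measureReal_def, signLaw_singleton]
  split_ifs <;> simp

theorem isStationaryOn_signLaw : IsStationaryOn threePointMatrix {negOne, one} signLaw where
  probability := ⟨by simp [signLaw, ENNReal.inv_two_add_inv_two]⟩
  carried := by
    have : ({negOne, one} : Set ThreePoint)ᶜ = {zero} := by
      ext x
      rcases threePoint_cases x with rfl | rfl | rfl <;>
        simp [negOne_ne_zero, negOne_ne_zero.symm, point_one_ne_zero, point_one_ne_zero.symm]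
    rw [this, signLaw_singleton, if_pos rfl]
  stationary := by
    intro y
    rw [sum_threePoint]
    simp only [signLaw_real_singleton, threePointMatrix, of_apply, negOne_ne_zero, point_one_ne_zero,
      if_false, if_true]
    split_ifs <;> norm_num

/-- Each row is symmetric about `0`. This makes the partial sums of the chain a martingale. -/
lemma threePointMatrix_mulVec_coe :
    threePointMatrix *ᵥ (fun x : ThreePoint => ((x : ℤ) : ℝ)) = 0 := by
  ext x
  simp only [mulVec, dotProduct, sum_threePoint, threePointMatrix, of_apply, negOne_ne_zero,
    point_one_ne_zero, if_false]
  split_ifs <;> simp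

lemma abs_coe_threePoint_le (x : ThreePoint) : |(x : ℤ)| ≤ 1 :=
  abs_le.2 ⟨x.2.1, x.2.2⟩

variable {Ω : Type*} [MeasurableSpace Ω] {ℙ : Measure Ω} [IsProbabilityMeasure ℙ]
  {Y : ℕ → Ω → ThreePoint}

/-- The partial sums of the three-point chain vanish infinitely often. -/
lemma ae_frequently_sum_eq_zero (hY : IsMarkovChain threePointMatrix Y ℙ) :
    ∀ᵐ ω ∂ℙ, ∃ᶠ n in atTop, ∑ i ∈ Finset.range (n + 1), (Y i ω : ℤ) = 0 := by
  have hM := hY.martingale_sum threePointMatrix_mulVec_coe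
  have hincr : ∀ ω n, |∑ i ∈ Finset.range (n + 1 + 1), (Y i ω : ℤ)
      - ∑ i ∈ Finset.range (n + 1), (Y i ω : ℤ)| ≤ 1 := fun ω n => by
    rw [Finset.sum_range_succ _ (n + 1), add_sub_cancel_left]
    exact abs_coe_threePoint_le _
  have hbdd : ∀ᵐ ω ∂ℙ, ∀ n, |∑ i ∈ Finset.range (n + 1 + 1), ((Y i ω : ℤ) : ℝ)
      - ∑ i ∈ Finset.range (n + 1), ((Y i ω : ℤ) : ℝ)| ≤ (1 : NNReal) :=
    ae_of_all _ fun ω n => by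
      have := Int.cast_le (R := ℝ).2 (hincr ω n)
      push_cast at this
      simpa using this
  -- For a martingale with bounded increments, almost surely boundedness above, boundedness below
  -- and convergence are equivalent.
  filter_upwards [hM.submartingale.bddAbove_iff_exists_tendsto hbdd,
    hM.bddAbove_range_iff_bddBelow_range hbdd,
    hY.ae_eventually_mem_right isDecomposition_threePointMatrix isStationaryOn_signLaw]
    with ω hconv hiff hev
  -- Convergence would force the increments to `0`, yet they are eventually `±1`.
  have hnot : ¬ BddAbove (Set.range fun n => ∑ i ∈ Finset.range (n + 1), ((Y i ω : ℤ) : ℝ)) := by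
    rw [hconv]
    rintro ⟨c, hc⟩
    have hd := ((tendsto_add_atTop_iff_nat 1).2 hc).sub hc
    simp only [Finset.sum_range_succ _ (_ + 1), add_sub_cancel_left, sub_self] at hd
    have h1 := hd.abs.eventually_lt_const (u := 1) (by simp)
    obtain ⟨n, hn, hn'⟩ := (h1.and ((tendsto_add_atTop_nat 1).eventually hev)).exists
    rcases hn' with h | h <;> rw [h] at hn <;> simp at hn
  refine frequently_eq_zero_of_not_bdd (hincr ω) (fun ⟨b, hb⟩ => hnot ⟨b, ?_⟩)
    (fun ⟨b, hb⟩ => hnot (hiff.2 ⟨b, ?_⟩))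
  · rintro _ ⟨n, rfl⟩
    have := Int.cast_le (R := ℝ).2 (hb ⟨n, rfl⟩)
    push_cast at this
    exact this
  · rintro _ ⟨n, rfl⟩
    have := Int.cast_le (R := ℝ).2 (hb ⟨n, rfl⟩)
    push_cast at this
    exact this

lemma loss_singleton_threePoint (p : ℝ) (μ : Measure ThreePoint) [IsFiniteMeasure μ]
    (t : ThreePoint) : loss p μ {t} = μ.real {negOne} * |(-1 - (t : ℤ) : ℝ)| ^ p
      + μ.real {zero} * |((t : ℤ) : ℝ)| ^ p + μ.real {one} * |(1 - (t : ℤ) : ℝ)| ^ p := by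
  rw [loss_eq_sum, sum_threePoint]
  simp [Metric.infDist_singleton, Subtype.dist_eq, Int.dist_eq]

/-- If `-1` and `1` both have mass `m` and `0` has mass `m₀`, the centre `0` costs `2m` and either
other centre costs `m₀ + 2 ^ p * m`, where `2 ^ p ≥ 2`. -/
lemma singleton_zero_mem_medoids {p : ℝ} (hp : 1 ≤ p) {μ : Measure ThreePoint} [IsFiniteMeasure μ]
    (h0 : 0 < μ.real {zero}) (hμ : μ.real {negOne} = μ.real {one}) :
    {zero} ∈ medoids 1 p μ := by
  refine ⟨⟨?_, by simp, by simp⟩, fun T hT => ?_⟩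
  · rw [Set.singleton_subset_iff]
    exact mem_support_iff_real_singleton_pos.2 h0
  · obtain ⟨t, rfl⟩ := Set.encard_eq_one.1 (le_antisymm (by simpa using hT.2.2) hT.2.1)
    -- Ensures `0 ^ p = 0`, so that a centre costs nothing at its own location.
    have hp0 : p ≠ 0 := by linarith
    have h2 : (2 : ℝ) ≤ 2 ^ p := by
      simpa using Real.rpow_le_rpow_of_exponent_le one_le_two hp
    have hone : 0 ≤ μ.real {one} := measureReal_nonneg
    have hle : μ.real {one} * 2 ≤ μ.real {one} * 2 ^ p := mul_le_mul_of_nonneg_left h2 hone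
    simp only [Set.mem_ofPred_eq, loss_singleton_threePoint, hμ]
    rcases threePoint_cases t with rfl | rfl | rfl
    · simp [hp0]
      norm_num
      linarith
    · rfl
    · simp [hp0]
      norm_num
      linarith

/-- The support of `signLaw` omits `0`, so each of its medoid sets is `{-1}` or `{1}`, at distance
`1` from `{0}`. -/
lemma one_le_maxMinHausdorff {p : ℝ} {C : Set (Set ThreePoint)} (hC : {zero} ∈ C) :
    1 ≤ maxMinHausdorff C (medoids 1 p signLaw) := by
  refine le_iSup₂_of_le {zero} hC (le_iInf₂ fun T hT => ?_)
  obtain ⟨t, rfl⟩ := Set.encard_eq_one.1 (le_antisymm (by simpa using hT.1.2.2) hT.1.2.1)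
  have ht : t ≠ zero := by
    rintro rfl
    have := mem_support_iff_measure_singleton_pos.1 (hT.1.1 (Set.mem_singleton zero))
    simp [signLaw_singleton] at this
  have h1 := Metric.infEDist_le_hausdorffEDist_of_mem (Set.mem_singleton zero)
    (t := ({t} : Set ThreePoint))
  rw [Metric.infEDist_singleton] at h1
  refine le_trans ?_ h1
  rw [edist_dist, ENNReal.one_le_ofReal, Subtype.dist_eq, Int.dist_eq]
  rcases threePoint_cases t with rfl | rfl | rfl
  · simp
  · exact absurd rfl ht
  · simp

/-- Without burn-in, the medoids of the three-point chain started at `0` are inconsistent. -/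
theorem ae_not_tendsto_maxMinHausdorff (hY : IsMarkovChain threePointMatrix Y ℙ)
    (hY0 : ∀ᵐ ω ∂ℙ, Y 0 ω = zero) {p : ℝ} (hp : 1 ≤ p) :
    ∀ᵐ ω ∂ℙ, ¬ Tendsto (fun n => maxMinHausdorff
        (medoids 1 p (empiricalMeasure (fun i => Y i ω) 0 n)) (medoids 1 p signLaw))
      atTop (𝓝 0) := by
  filter_upwards [ae_frequently_sum_eq_zero hY, hY0] with ω hω h0 hlim
  have hlt := ((tendsto_add_atTop_iff_nat 1).2 hlim).eventually_lt_const one_pos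
  obtain ⟨n, hn, hlt⟩ := (hω.and_eventually hlt).exists
  refine (one_le_maxMinHausdorff (singleton_zero_mem_medoids hp ?_ ?_)).not_gt hlt
  -- The initial point `Y 0 ω = 0` is never discarded, so `0` keeps positive mass.
  · rw [empiricalMeasure_real_singleton]
    refine div_pos (Finset.sum_pos' (fun i _ => by split_ifs <;> simp) ⟨0, by simp, ?_⟩)
      (by simp; positivity)
    simp [h0]
  · rw [empiricalMeasure_real_singleton, empiricalMeasure_real_singleton]
    congr 1
    -- The number of visits to `1` minus the number of visits to `-1` is the partial sum, which
    -- vanishes at this time.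
    rw [← sub_eq_zero, ← neg_eq_zero, neg_sub, ← Finset.sum_sub_distrib, ← Finset.range_eq_Ico]
    rw [← @Int.cast_inj ℝ, Int.cast_zero, Int.cast_sum] at hn
    refine Eq.trans (Finset.sum_congr rfl fun i _ => ?_) hn
    rcases threePoint_cases (Y i ω) with h | h | h <;> rw [h]
    · simp [negOne_ne_one]
    · simp [negOne_ne_zero.symm, point_one_ne_zero.symm]
    · simp [negOne_ne_one.symm]

end ThreePointChain

end BurnInMedoids

theorem theorem4p4 :
    -- Strong consistency of medoids with burn-in.
    (∀ (X : Type*) [MetricSpace X] [Fintype X] [DecidableEq X] [MeasurableSpace X] [BorelSpace X]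
      (P : Matrix X X ℝ) (X₀ X₁ : Set X) (_ : BurnInMedoids.IsDecomposition P X₀ X₁)
      (ν : Measure X) (_ : BurnInMedoids.IsStationaryOn P X₁ ν)
      (Ω : Type*) [MeasurableSpace Ω] (ℙ : Measure Ω) [IsProbabilityMeasure ℙ]
      (Y : ℕ → Ω → X) (_ : BurnInMedoids.IsMarkovChain P Y ℙ) (_ : ∀ᵐ ω ∂ℙ, Y 0 ω ∈ X₀)
      (f : ℕ → ℕ) (_ : ∀ n, f n ≤ n) (_ : Tendsto f atTop atTop)
      (_ : Tendsto (fun n => (f n : ℝ) / (n : ℝ)) atTop (𝓝 0))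
      (k : ℕ) (_ : 1 ≤ k) (p : ℝ) (_ : 1 ≤ p),
      ∀ᵐ ω ∂ℙ,
        (∀ᶠ n in atTop, (BurnInMedoids.medoids k p
          (BurnInMedoids.empiricalMeasure (fun i => Y i ω) (f n) n)).Nonempty) ∧
        Tendsto (fun n => BurnInMedoids.maxMinHausdorff
            (BurnInMedoids.medoids k p
              (BurnInMedoids.empiricalMeasure (fun i => Y i ω) (f n) n))
            (BurnInMedoids.medoids k p ν))
          atTop (𝓝 0)) ∧
    -- The three-point chain is of the above kind, and without burn-in it is inconsistent.
    (BurnInMedoids.IsDecomposition BurnInMedoids.threePointMatrix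
        {BurnInMedoids.zero} {BurnInMedoids.negOne, BurnInMedoids.one} ∧
      BurnInMedoids.IsStationaryOn BurnInMedoids.threePointMatrix
        {BurnInMedoids.negOne, BurnInMedoids.one} BurnInMedoids.signLaw ∧
      ∀ (Ω : Type*) [MeasurableSpace Ω] (ℙ : Measure Ω) [IsProbabilityMeasure ℙ]
        (Y : ℕ → Ω → BurnInMedoids.ThreePoint)
        (_ : BurnInMedoids.IsMarkovChain BurnInMedoids.threePointMatrix Y ℙ)
        (_ : ∀ᵐ ω ∂ℙ, Y 0 ω = BurnInMedoids.zero) (p : ℝ) (_ : 1 ≤ p),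
        ∀ᵐ ω ∂ℙ, ¬ Tendsto (fun n => BurnInMedoids.maxMinHausdorff
            (BurnInMedoids.medoids 1 p
              (BurnInMedoids.empiricalMeasure (fun i => Y i ω) 0 n))
            (BurnInMedoids.medoids 1 p BurnInMedoids.signLaw))
          atTop (𝓝 0)) := by
  refine ⟨?_, BurnInMedoids.isDecomposition_threePointMatrix,
    BurnInMedoids.isStationaryOn_signLaw, ?_⟩
  · intro X _ _ _ _ _ P X₀ X₁ hD ν hν Ω _ ℙ _ Y hY _ f hf hf' hfn k hk p _
    exact hY.ae_medoids_consistent hD hν hf hf' hfn hk p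
  · intro Ω _ ℙ _ Y hY hY0 p hp
    exact BurnInMedoids.ae_not_tendsto_maxMinHausdorff hY hY0 hp
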